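/- Let $n\ge 1$, let $X\subset\mathbb{R}^n$ be a solid (a convex compact set with nonempty interior) and let $F:X\to\mathbb{R}\cup\{+\infty\}$ be convex and finite on $\operatorname{int}X$; consider $\mathrm{Opt}=\inf_X F$. A $\delta$-subgradient of $F$ at $x$ is a vector $e$ with $F(y)\ge F(x)+\langle e,y-x\rangle-\delta$ for all $y\in X$. A polytope-based cutting plane algorithm with $\delta$-oracle generates full-dimensional bounded polytopes $Q_1\supseteq X,Q_2,\dots$ and points $x_t\in\operatorname{int}Q_t$. At step $t$, $e_t$ is a $\delta$-subgradient of $F$ at $x_t$ if $x_t\in\operatorname{int}X$ (a productive step; the algorithm terminates if $e_t=0$); otherwise $e_t\ne0$ and $\langle e_t,y-x_t\rangle\le 0$ for all $y\in X$ (a nonproductive step). Then $Q_{t+1}\supseteq\{y\in Q_t:\langle e_t,y-x_t\rangle\le0\}$ is obtained from the system of linear inequalities defining $Q_t$ by removing some inequalities and adding at most one, whose normal vector is $e_t$. Let $\tau\ge1$ be a nonterminal step and $Q_{\tau+1}=\{y: \langle a_i,y\rangle\le b_i,\ i=1,\dots,m\}$. Let $\mathcal P_\tau$ and $\mathcal N_\tau$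 be the sets of indices of the constraints added at productive, respectively nonproductive, steps, and for $i\in\mathcal P_\tau\cup\mathcal N_\tau$ let $t(i)$ be the step at which constraint $i$ was added (so $a_i=e_{t(i)}$). Let $I_\tau$ be the set of productive steps $t\le\tau$. Consider the linear program $$\max_{\lambda\in\mathbb{R}^m} D_\tau(\lambda)=\sum_{i\in\mathcal P_\tau}\lambda_i\|a_i\|_2\quad\text{s.t. } \lambda\ge0,\ \sum_i\lambda_ia_i=0,\ \sum_i\lambda_ib_i\in[0,2],$$ with an optimal solution $\lambda^*$. For feasible $\lambda$ with $d_\tau=\sum_{i\in\mathcal P_\tau}\lambda_i>0$, the induced certificate $\xi$ is given by $\xi_{t(i)}=\lambda_i/d_\tau$ for $i\in\mathcal P_\tau\cup\mathcal N_\tau$ and $\xi_t=0$ for all other steps $t\le\tau$. Put $\epsilon_{\mathrm{cert}}(\xi)=\max_{y\in Q_1}\sum_{t=1}^\tau\xi_t\langle e_t,x_t-y\rangle$, $x^\tau[\xi]=\sum_{t\in I_\tau}\xi_tx_t$ and $W_\tau=\max_{t\in I_\tau}\max_{y\in X}\langle e_t,y-x_t\rangle$. Let $\rho(B)$ be the radius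 of the Euclidean ball with the same volume as $B$, let $D(Q_1)$ be the Euclidean diameter of $Q_1$, and let $r$ be the largest radius of a Euclidean ball contained in $X$. Let $\alpha\in[0,1)$. (1) If $\rho(Q_{\tau+1})\le\dfrac{(1-\alpha)r^2}{16nD(Q_1)}$ and $\lambda$ is feasible for the linear program with $D_\tau(\lambda)\ge(1-\alpha)D_\tau(\lambda^*)$, then $\xi$ is well defined and is a certificate, that is, $d_\tau>0$, $\xi_t\ge0$ for $t\le\tau$ and $\sum_{t\in I_\tau}\xi_t=1$; moreover $$\epsilon_{\mathrm{cert}}(\xi)\le\frac{16nD(Q_1)W_\tau}{(1-\alpha)r^2}\,\rho(Q_{\tau+1}).$$ If in addition $\sup_{x,y\in X}(F(x)-F(y))\le C<\infty$, then $W_\tau\le C+\delta$ and $$\epsilon_{\mathrm{cert}}(\xi)\le\frac{16nD(Q_1)(C+\delta)}{(1-\alpha)r^2}\,\rho(Q_{\tau+1}).$$ (2) Consequently, suppose that $\sup_{x,y\in X}(F(x)-F(y))\le C<\infty$, that the algorithm never terminates, that $\rho(Q_t)\to0$, and that for each $\tau\ge1$ a feasible $\lambda^{(\tau)}$ with $D_\tau(\lambda^{(\tau)})\ge(1-\alpha)D_\tau(\lambda^*)$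 is chosen, with induced certificate $\xi^{(\tau)}$. Then for every $\eta>0$ one has $\epsilon_{\mathrm{cert}}(\xi^{(\tau)})\le\eta$ for all sufficiently large $\tau$, and for every $\varepsilon>\delta$ the point $x^\tau[\xi^{(\tau)}]$ lies in $\operatorname{int}X$ and satisfies $F(x^\tau[\xi^{(\tau)}])\le\mathrm{Opt}+\varepsilon$ for all sufficiently large $\tau$. -/

import Mathlib

open Set Filter Topology MeasureTheory

/-- The space `ℝⁿ` with its Euclidean structure. -/
abbrev Euc (n : ℕ) : Type := EuclideanSpace ℝ (Fin n)

/-- The radius of the Euclidean ball in `ℝⁿ` with the same volume as `B`. -/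
noncomputable def rho {n : ℕ} (B : Set (Euc n)) : ℝ :=
  (volume B / volume (Metric.ball (0 : Euc n) 1)).toReal ^ ((n : ℝ)⁻¹)

/-- `rho B` is indeed the radius of a ball with the volume of `B`. -/
theorem volume_ball_rho {n : ℕ} (hn : 0 < n) (B : Set (Euc n)) (hB : volume B ≠ ⊤) :
    0 ≤ rho B ∧ volume (Metric.ball (0 : Euc n) (rho B)) = volume B := by
  have h0 : 0 ≤ rho B := Real.rpow_nonneg ENNReal.toReal_nonneg _
  have hp : volume (Metric.ball (0 : Euc n) 1) ≠ 0 :=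
    (Metric.measure_ball_pos volume (0 : Euc n) one_pos).ne'
  have hf : volume (Metric.ball (0 : Euc n) 1) ≠ ⊤ := measure_ball_lt_top.ne
  have : Nonempty (Fin n) := ⟨⟨0, hn⟩⟩
  refine ⟨h0, ?_⟩
  rw [Measure.addHaar_ball volume (0 : Euc n) h0, finrank_euclideanSpace_fin, rho,
    ← Real.rpow_natCast, ← Real.rpow_mul ENNReal.toReal_nonneg,
    inv_mul_cancel₀ (by positivity), Real.rpow_one,
    ENNReal.ofReal_toReal (ENNReal.div_ne_top hB hp), ENNReal.div_mul_cancel hp hf]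

/-- The largest of the radii of Euclidean balls contained in `X`. -/
noncomputable def inradius {n : ℕ} (X : Set (Euc n)) : ℝ :=
  sSup {s : ℝ | 0 ≤ s ∧ ∃ c : Euc n, Metric.closedBall c s ⊆ X}

/-- A convex minimization problem `min_{x ∈ X} F x`: `X` is a solid, `F : X → ℝ ∪ {+∞}` is convex
and finite on the interior of `X`. The values of `F` outside `X` are irrelevant. -/
structure ConvexProblem (n : ℕ) where
  X : Set (Euc n)
  F : Euc n → EReal
  convex_X : Convex ℝ X
  compact_X : IsCompact X
  interior_nonempty : (interior X).Nonempty
  F_ne_bot : ∀ x ∈ X, F x ≠ ⊥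
  F_ne_top : ∀ x ∈ interior X, F x ≠ ⊤
  /-- convexity of `F` on `X`, by convexity of its epigraph -/
  convex_F : Convex ℝ {p : Euc n × ℝ | p.1 ∈ X ∧ F p.1 ≤ (p.2 : EReal)}

namespace ConvexProblem

variable {n : ℕ} (P : ConvexProblem n)

/-- The optimal value of the problem. -/
noncomputable def opt : EReal := ⨅ y ∈ P.X, P.F y

/-- `x` is a strictly feasible `ε`-optimal solution. -/
def IsEpsOptimal (ε : ℝ) (x : Euc n) : Prop :=
  x ∈ interior P.X ∧ P.F x ≤ P.opt + (ε : EReal)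

/-- `e` is a `δ`-subgradient of `F` at `x`. -/
def IsDeltaSubgradient (δ : ℝ) (x e : Euc n) : Prop :=
  ∀ y ∈ P.X, P.F x + ((inner ℝ e (y - x) - δ : ℝ) : EReal) ≤ P.F y

/-- The variation `sup_{x, y ∈ X} (F x - F y)` is at most `C`. -/
def VariationLE (C : ℝ) : Prop :=
  ∀ x ∈ P.X, ∀ y ∈ P.X, P.F x - P.F y ≤ (C : EReal)

end ConvexProblem

/-- The data generated by a polytope-based cutting plane algorithm; steps are numbered from `1`.
A constraint is named by a label: `Sum.inl i` is the `i`-th constraint of the initial polytope,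
`Sum.inr t` is the constraint added at step `t` (its normal is the vector `e t`, its right-hand
side is `cutOffset t`). The constraints forming the localizer at step `t` are those in
`active t`. -/
structure CuttingPlaneTrace (n : ℕ) where
  m : ℕ
  initNormal : Fin m → Euc n
  initOffset : Fin m → ℝ
  x : ℕ → Euc n
  e : ℕ → Euc n
  cutOffset : ℕ → ℝ
  active : ℕ → Finset (Fin m ⊕ ℕ)

namespace CuttingPlaneTrace

variable {n : ℕ} (T : CuttingPlaneTrace n) (P : ConvexProblem n)

/-- The normal vector `a_i` of a constraint `⟨a_i, y⟩ ≤ b_i`. -/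
def a : Fin T.m ⊕ ℕ → Euc n := Sum.elim T.initNormal T.e

/-- The right-hand side `b_i` of a constraint `⟨a_i, y⟩ ≤ b_i`. -/
def b : Fin T.m ⊕ ℕ → ℝ := Sum.elim T.initOffset T.cutOffset

/-- The localizer at step `t`. -/
def Q (t : ℕ) : Set (Euc n) := {y | ∀ i ∈ T.active t, inner ℝ (T.a i) y ≤ T.b i}

/-- `T` records the first `τ` steps, all of them nonterminal, of a polytope-based cutting plane
algorithm with `δ`-oracle applied to `P`, including the localizer `T.Q (τ + 1)` formed at
step `τ`. -/
structure IsRun (δ : ℝ) (τ : ℕ) : Prop where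
  active_one : T.active 1 = Finset.univ.image Sum.inl
  X_subset : P.X ⊆ T.Q 1
  bounded : ∀ t ∈ Finset.Icc 1 (τ + 1), Bornology.IsBounded (T.Q t)
  interior_nonempty : ∀ t ∈ Finset.Icc 1 (τ + 1), (interior (T.Q t)).Nonempty
  x_mem : ∀ t ∈ Finset.Icc 1 τ, T.x t ∈ interior (T.Q t)
  /-- productive step: the `δ`-oracle returns a `δ`-subgradient -/
  productive : ∀ t ∈ Finset.Icc 1 τ, T.x t ∈ interior P.X →
    P.IsDeltaSubgradient δ (T.x t) (T.e t)
  /-- nonproductive step: the separation oracle returns a separator -/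
  nonproductive : ∀ t ∈ Finset.Icc 1 τ, T.x t ∉ interior P.X →
    ∀ y ∈ P.X, inner ℝ (T.e t) (y - T.x t) ≤ 0
  /-- separators are nonzero, and the algorithm does not terminate at a productive step -/
  e_ne_zero : ∀ t ∈ Finset.Icc 1 τ, T.e t ≠ 0
  /-- constraints can be removed, and the only one that can be added at step `t` has normal
  `e t` -/
  active_succ : ∀ t ∈ Finset.Icc 1 τ, T.active (t + 1) ⊆ insert (Sum.inr t) (T.active t)
  /-- the next localizer contains the part of the current one that is cut out by `e t` -/
  cut_subset : ∀ t ∈ Finset.Icc 1 τ,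
    {y | y ∈ T.Q t ∧ inner ℝ (T.e t) (y - T.x t) ≤ 0} ⊆ T.Q (t + 1)

open Classical in
/-- The indices of productive steps among `1, …, τ`. -/
noncomputable def prodSteps (τ : ℕ) : Finset ℕ :=
  (Finset.Icc 1 τ).filter fun t => T.x t ∈ interior P.X

/-- The collection of weights `ξ` is a certificate for the protocol of the first `τ` steps. -/
def IsCertificate (τ : ℕ) (ξ : ℕ → ℝ) : Prop :=
  (∀ t ∈ Finset.Icc 1 τ, 0 ≤ ξ t) ∧ ∑ t ∈ T.prodSteps P τ, ξ t = 1

/-- The residual of `ξ` on `B`. -/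
noncomputable def epsCert (τ : ℕ) (ξ : ℕ → ℝ) (B : Set (Euc n)) : ℝ :=
  sSup ((fun y => ∑ t ∈ Finset.Icc 1 τ, ξ t * inner ℝ (T.e t) (T.x t - y)) '' B)

/-- The approximate solution induced by `ξ`. -/
noncomputable def approxSol (τ : ℕ) (ξ : ℕ → ℝ) : Euc n :=
  ∑ t ∈ T.prodSteps P τ, ξ t • T.x t

/-- `W_τ`, the maximum of `⟨e_t, y - x_t⟩` over productive steps `t ≤ τ` and `y ∈ X`. -/
noncomputable def W (τ : ℕ) : ℝ :=
  sSup {w : ℝ | ∃ t ∈ T.prodSteps P τ, ∃ y ∈ P.X, w = inner ℝ (T.e t) (y - T.x t)}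

open Classical in
/-- The constraints of the localizer `Q (τ + 1)` that were added at productive steps. -/
noncomputable def prodCuts (τ : ℕ) : Finset (Fin T.m ⊕ ℕ) :=
  (T.active (τ + 1)).filter fun i => ∃ t, i = Sum.inr t ∧ T.x t ∈ interior P.X

/-- The objective of the linear program. Only the values of `lam` on `T.active (τ + 1)` matter
here and below. -/
noncomputable def lpObj (τ : ℕ) (lam : Fin T.m ⊕ ℕ → ℝ) : ℝ :=
  ∑ i ∈ T.prodCuts P τ, lam i * ‖T.a i‖

/-- Feasibility: `λ ≥ 0`, `Aᵀ λ = 0`, `bᵀ λ ∈ [0, 2]` for the system `A y ≤ b` defining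
`Q (τ + 1)`. -/
def LPFeasible (τ : ℕ) (lam : Fin T.m ⊕ ℕ → ℝ) : Prop :=
  (∀ i ∈ T.active (τ + 1), 0 ≤ lam i) ∧
  ∑ i ∈ T.active (τ + 1), lam i • T.a i = 0 ∧
  ∑ i ∈ T.active (τ + 1), lam i * T.b i ∈ Set.Icc (0 : ℝ) 2

/-- Optimality of a feasible point of the linear program. -/
def LPOptimal (τ : ℕ) (lam : Fin T.m ⊕ ℕ → ℝ) : Prop :=
  T.LPFeasible τ lam ∧ ∀ mu, T.LPFeasible τ mu → T.lpObj P τ mu ≤ T.lpObj P τ lam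

/-- `d_τ`, the total weight of the constraints added at productive steps. -/
noncomputable def dSum (τ : ℕ) (lam : Fin T.m ⊕ ℕ → ℝ) : ℝ := ∑ i ∈ T.prodCuts P τ, lam i

/-- The weights `ξ` induced by `λ`; meaningful if `d_τ > 0`. -/
noncomputable def certOf (τ : ℕ) (lam : Fin T.m ⊕ ℕ → ℝ) (t : ℕ) : ℝ :=
  if Sum.inr t ∈ T.active (τ + 1) then lam (Sum.inr t) / T.dSum P τ lam else 0

end CuttingPlaneTrace

/-! Every estimate tests one identity: if `λ` is feasible, then `∑ λ_i (b_i - ⟨a_i, y⟩) = ∑ λ_i b_i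
≤ 2` for every `y`, because `∑ λ_i a_i = 0`. What varies is the lower bound for the slacks. A cut
made at step `t` has `b_i ≥ ⟨e_t, x_t⟩`, and every constraint not coming from a productive step is
valid on `X`.

For `y` in `Q_1` the initial constraints have nonnegative slack, so the residual of the induced
certificate is at most `2 / d` (`residual_le`). It remains to bound `d` from below. At the centre of
a ball of radius `r` in `X`, the identity gives `r D(λ) - 2 ≤ W d` (`lpObj_mul_le`), so a large
objective forces a large `d`.

A large objective is available because a localizer with small volume contains no ball of radius `s =
2ρ`. Gordan's alternative turns this into a feasible `λ` with `∑ λ_i ‖a_i‖ = 2 / s`, and testing it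
at the same centre shows that a sizeable part of this sum sits on productive cuts
(`exists_feasible`). Near-optimality transfers the bound to the chosen `λ`.

For the second claim, `W ≤ C + δ` makes the bound a constant times `ρ`, and Jensen's inequality
turns a small residual into near-optimality of the averaged point (`isEpsOptimal`). -/

/-! ### Gordan's alternative for strict linear inequalities -/

theorem nonneg_of_forall_nonneg_add_mul {A B : ℝ} (h : ∀ t : ℝ, 0 ≤ t → 0 ≤ A + t * B) :
    0 ≤ B := by
  by_contra! hB
  have h1 := h ((|A| + 1) / (-B)) (by have := abs_nonneg A; apply div_nonneg <;> linarith)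
  have h2 : (|A| + 1) / (-B) * B = -(|A| + 1) := by field_simp [hB.ne]
  have := le_abs_self A
  linarith

/-- Gordan's alternative: an infeasible finite system of strict linear inequalities admits a
nontrivial nonnegative combination that is contradictory. -/
theorem exists_nonneg_combination_of_infeasible {E ι : Type*} [NormedAddCommGroup E]
    [InnerProductSpace ℝ E] (s : Finset ι) (a : ι → E) (c : ι → ℝ)
    (h : ∀ z, ∃ i ∈ s, c i ≤ inner ℝ (a i) z) :
    ∃ μ : ι → ℝ, (∀ i, 0 ≤ μ i) ∧ (∃ i ∈ s, 0 < μ i) ∧ ∑ i ∈ s, μ i • a i = 0 ∧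
      ∑ i ∈ s, μ i * c i ≤ 0 := by
  classical
  -- Infeasibility says exactly that `0` is outside this open convex set, which is closed upwards.
  -- The coordinates of a separating functional are the multipliers.
  let S : Set (s → ℝ) := {w | ∃ z, ∀ i : s, inner ℝ (a i) z - c i < w i}
  have hSo : IsOpen S := by
    have : S = ⋃ z, ⋂ i : s, {w : s → ℝ | inner ℝ (a i) z - c i < w i} := by
      ext w; simp [S]
    rw [this]
    exact isOpen_iUnion fun z => isOpen_iInter_of_finite fun i =>
      isOpen_lt continuous_const (continuous_apply i)
  have hSc : Convex ℝ S := by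
    rintro w ⟨z, hz⟩ w' ⟨z', hz'⟩ p q hp hq hpq
    refine ⟨p • z + q • z', fun i => ?_⟩
    have e : inner ℝ (a i) (p • z + q • z') - c i
        = p * (inner ℝ (a i) z - c i) + q * (inner ℝ (a i) z' - c i) := by
      rw [inner_add_right, inner_smul_right, inner_smul_right]
      linear_combination c i * hpq
    rw [e]
    simp only [Pi.add_apply, Pi.smul_apply, smul_eq_mul]
    rcases hp.eq_or_lt with rfl | hp
    · obtain rfl : q = 1 := by linarith
      simpa using hz' i
    · exact add_lt_add_of_lt_of_le (mul_lt_mul_of_pos_left (hz i) hp)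
        (mul_le_mul_of_nonneg_left (hz' i).le hq)
  have h0 : (0 : s → ℝ) ∉ S := by
    rintro ⟨z, hz⟩
    obtain ⟨i, hi, hle⟩ := h z
    have := hz ⟨i, hi⟩
    simp only [Pi.zero_apply] at this
    linarith
  obtain ⟨f, hf⟩ := geometric_hahn_banach_point_open hSc hSo h0
  simp only [map_zero] at hf
  have hf' : ∀ z, ∀ w : s → ℝ, (∀ i : s, inner ℝ (a i) z - c i ≤ w i) → 0 ≤ f w := by
    intro z w hw
    by_contra! hneg
    have hd : (0 : ℝ) < |f 1| + 1 := by positivity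
    -- With this `ε`, `w + ε • 1` lies in `S`, yet `f w + ε * f 1 ≤ -ε < 0`.
    have hε : 0 < -f w / (|f 1| + 1) := div_pos (by linarith) hd
    have h1 := hf (w + (-f w / (|f 1| + 1)) • 1) ⟨z, fun i => by
      simp only [Pi.add_apply, Pi.smul_apply, smul_eq_mul, Pi.one_apply, mul_one]
      linarith [hw i]⟩
    rw [map_add, map_smul, smul_eq_mul] at h1
    have h2 : -f w / (|f 1| + 1) * f 1 ≤ -f w / (|f 1| + 1) * |f 1| :=
      mul_le_mul_of_nonneg_left (le_abs_self _) hε.le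
    have h3 : -f w / (|f 1| + 1) * (|f 1| + 1) = -f w := div_mul_cancel₀ _ hd.ne'
    linarith
  let μ : ι → ℝ := fun i => if hi : i ∈ s then f (Pi.single ⟨i, hi⟩ 1) else 0
  have hμ : ∀ i : s, μ i = f (Pi.single i 1) := fun i => by simp [μ]
  have hfsum : ∀ w : ι → ℝ, f (fun i : s => w i) = ∑ i ∈ s, μ i * w i := by
    intro w
    conv_lhs => rw [← Finset.univ_sum_single (fun i : s => w i)]
    rw [map_sum, ← Finset.sum_coe_sort s]
    refine Finset.sum_congr rfl fun i _ => ?_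
    rw [hμ, mul_comm, ← smul_eq_mul, ← map_smul, ← Pi.single_smul, smul_eq_mul, mul_one]
  have hμ0 : ∀ i, 0 ≤ μ i := by
    intro i
    by_cases hi : i ∈ s
    · refine nonneg_of_forall_nonneg_add_mul (A := f fun i : s => -c i) fun t ht => ?_
      rw [show μ i = f (Pi.single ⟨i, hi⟩ 1) by simp [μ, hi], ← smul_eq_mul, ← map_smul, ← map_add]
      refine hf' 0 _ fun j => ?_
      have : (0 : ℝ) ≤ (Pi.single (⟨i, hi⟩ : s) (1 : ℝ) : s → ℝ) j := by
        rw [Pi.single_apply]; split_ifs <;> norm_num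
      simp only [inner_zero_right, zero_sub, Pi.add_apply, Pi.smul_apply, smul_eq_mul]
      nlinarith [mul_nonneg ht this]
    · simp [μ, hi]
  have hz0 : ∀ z, 0 ≤ ∑ i ∈ s, μ i * inner ℝ (a i) z := by
    intro z
    refine nonneg_of_forall_nonneg_add_mul (A := ∑ i ∈ s, μ i * -c i) fun t ht => ?_
    have := hf' (t • z) (fun i : s => -c i + t * inner ℝ (a i) z) fun i => by
      rw [inner_smul_right]; linarith
    rw [hfsum fun i => -c i + t * inner ℝ (a i) z] at this
    rw [Finset.mul_sum, ← Finset.sum_add_distrib]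
    exact this.trans_eq (Finset.sum_congr rfl fun i _ => by ring)
  refine ⟨μ, hμ0, ?_, ?_, ?_⟩
  · by_contra! hne
    have h1 := hf (fun i : s => -c i + 1) ⟨0, fun i => by simp⟩
    rw [hfsum fun i => -c i + 1] at h1
    rw [Finset.sum_eq_zero fun i hi => by rw [le_antisymm (hne i hi) (hμ0 i), zero_mul]] at h1
    exact lt_irrefl _ h1
  -- A linear form in `z` that is nonnegative everywhere vanishes; testing at minus its own vector
  -- shows it.
  · have h1 := hz0 (-∑ i ∈ s, μ i • a i)
    have h2 : ∑ i ∈ s, μ i * inner ℝ (a i) (-∑ i ∈ s, μ i • a i)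
        = -inner ℝ (∑ i ∈ s, μ i • a i) (∑ i ∈ s, μ i • a i) := by
      simp only [sum_inner, inner_neg_right, real_inner_smul_left, mul_neg,
        Finset.sum_neg_distrib]
    rw [h2] at h1
    have h3 := real_inner_self_nonneg (x := ∑ i ∈ s, μ i • a i)
    exact inner_self_eq_zero.1 (le_antisymm (by linarith) h3)
  · have := hf' 0 (fun i : s => -c i) fun i => by simp
    rw [hfsum fun i => -c i] at this
    simp only [mul_neg, Finset.sum_neg_distrib] at this
    linarith

/-! ### Balls, volume radius and inradius -/

theorem le_rho_of_ball_subset {n : ℕ} (hn : 0 < n) {B : Set (Euc n)} (hB : Bornology.IsBounded B)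
    {z : Euc n} {s : ℝ} (h : Metric.ball z s ⊆ B) : s ≤ rho B := by
  have : Nonempty (Fin n) := ⟨⟨0, hn⟩⟩
  obtain ⟨h0, h1⟩ := volume_ball_rho hn B hB.measure_lt_top.ne
  by_contra! hlt
  have h2 := measure_mono (μ := volume) h
  have hp : 0 < volume (Metric.ball (0 : Euc n) 1) := Metric.measure_ball_pos volume _ one_pos
  rw [← h1, Measure.addHaar_ball volume z (h0.trans hlt.le), Measure.addHaar_ball volume _ h0,
    ENNReal.mul_le_mul_iff_left hp.ne' measure_ball_lt_top.ne,
    ENNReal.ofReal_le_ofReal_iff (by positivity), finrank_euclideanSpace_fin] at h2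
  exact absurd h2 (not_le.2 (pow_lt_pow_left₀ hlt h0 hn.ne'))

theorem rho_pos {n : ℕ} (hn : 0 < n) {B : Set (Euc n)} (hB : Bornology.IsBounded B)
    (hi : (interior B).Nonempty) : 0 < rho B := by
  obtain ⟨x, hx⟩ := hi
  obtain ⟨s, hs, h⟩ := Metric.isOpen_iff.1 isOpen_interior x hx
  exact hs.trans_le (le_rho_of_ball_subset hn hB (h.trans interior_subset))

theorem le_diam_of_closedBall_subset {n : ℕ} (hn : 0 < n) {B : Set (Euc n)}
    (hB : Bornology.IsBounded B) {c : Euc n} {s : ℝ} (hs : 0 ≤ s)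
    (h : Metric.closedBall c s ⊆ B) : s ≤ Metric.diam B := by
  have h1 : c + EuclideanSpace.single (⟨0, hn⟩ : Fin n) s ∈ B := h (by simp [abs_of_nonneg hs])
  have h2 := Metric.dist_le_diam_of_mem hB h1 (h (Metric.mem_closedBall_self hs))
  simpa [abs_of_nonneg hs] using h2

theorem bddAbove_inradius_set {n : ℕ} (hn : 0 < n) {X : Set (Euc n)}
    (hX : Bornology.IsBounded X) :
    BddAbove {s : ℝ | 0 ≤ s ∧ ∃ c : Euc n, Metric.closedBall c s ⊆ X} :=
  ⟨Metric.diam X, fun _ ⟨hs, _, hc⟩ => le_diam_of_closedBall_subset hn hX hs hc⟩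

theorem inradius_pos {n : ℕ} (hn : 0 < n) {X : Set (Euc n)} (hX : Bornology.IsBounded X)
    (hi : (interior X).Nonempty) : 0 < inradius X := by
  obtain ⟨x, hx⟩ := hi
  obtain ⟨s, hs, h⟩ := Metric.nhds_basis_closedBall.mem_iff.1 (mem_interior_iff_mem_nhds.1 hx)
  exact hs.trans_le (le_csSup (bddAbove_inradius_set hn hX) ⟨hs.le, x, h⟩)

theorem inradius_le_diam {n : ℕ} (hn : 0 < n) {X B : Set (Euc n)} (hB : Bornology.IsBounded B)
    (hXB : X ⊆ B) : inradius X ≤ Metric.diam B :=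
  Real.sSup_le (fun _ ⟨hs, _, hc⟩ => le_diam_of_closedBall_subset hn hB hs (hc.trans hXB))
    Metric.diam_nonneg

theorem exists_closedBall_subset_of_lt_inradius {n : ℕ} {X : Set (Euc n)} {s : ℝ} (h0 : 0 < s)
    (hs : s < inradius X) : ∃ r c, s < r ∧ Metric.closedBall c r ⊆ X := by
  have hne : {s : ℝ | 0 ≤ s ∧ ∃ c : Euc n, Metric.closedBall c s ⊆ X}.Nonempty := by
    by_contra! he
    rw [inradius, he, Real.sSup_empty] at hs
    exact lt_asymm h0 hs
  obtain ⟨r, ⟨-, c, hc⟩, hr⟩ := exists_lt_of_lt_csSup hne hs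
  exact ⟨r, c, hr, hc⟩

/-- The point is the maximizer of `⟨a, ·⟩` over the closed ball of radius `r` about `c`. For `a = 0`
the convention `r / 0 = 0` makes it `c`. -/
theorem inner_add_smul_div_norm {E : Type*} [NormedAddCommGroup E] [InnerProductSpace ℝ E]
    (a c : E) (r : ℝ) : inner ℝ a (c + (r / ‖a‖) • a) = inner ℝ a c + r * ‖a‖ := by
  rw [inner_add_right, inner_smul_right, real_inner_self_eq_norm_sq]
  rcases eq_or_ne ‖a‖ 0 with h | h
  · simp [h]
  · field_simp

theorem add_smul_div_norm_mem_closedBall {E : Type*} [NormedAddCommGroup E] [NormedSpace ℝ E]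
    (a c : E) {r : ℝ} (hr : 0 ≤ r) : c + (r / ‖a‖) • a ∈ Metric.closedBall c r := by
  rw [Metric.mem_closedBall, dist_eq_norm, add_sub_cancel_left, norm_smul, norm_div, norm_norm,
    Real.norm_of_nonneg hr]
  rw [div_mul_eq_mul_div]
  exact div_le_of_le_mul₀ (norm_nonneg _) hr le_rfl

/-! ### Validity of cuts and localizers -/

namespace CuttingPlaneTrace

variable {n : ℕ} {T : CuttingPlaneTrace n} {P : ConvexProblem n} {δ : ℝ} {τ : ℕ}

/-- A cut can enter the system only at its own step, so one that is still active was already active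
in the localizer formed at that step. -/
theorem IsRun.cut_label (h : T.IsRun P δ τ) {t s : ℕ} (ht : 1 ≤ t) (htτ : t ≤ τ + 1)
    (hs : Sum.inr s ∈ T.active t) : 1 ≤ s ∧ s < t ∧ Sum.inr s ∈ T.active (s + 1) := by
  induction t, ht using Nat.le_induction with
  | base => simp [h.active_one] at hs
  | succ t ht ih =>
    rcases Finset.mem_insert.1 (h.active_succ t (Finset.mem_Icc.2 ⟨ht, by omega⟩) hs) with h1 | h1
    · obtain rfl : s = t := Sum.inr_injective h1
      exact ⟨ht, by omega, hs⟩
    · obtain ⟨h2, h3, h4⟩ := ih (by omega) h1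
      exact ⟨h2, by omega, h4⟩

/-- The query point lies in its localizer and on the boundary of the half-space being kept. It
therefore survives into the next localizer, where the new constraint is active. -/
theorem IsRun.inner_le_cutOffset (h : T.IsRun P δ τ) {s : ℕ}
    (hs : Sum.inr s ∈ T.active (τ + 1)) :
    s ∈ Finset.Icc 1 τ ∧ inner ℝ (T.e s) (T.x s) ≤ T.cutOffset s := by
  obtain ⟨h1, h2, h3⟩ := h.cut_label (by omega) le_rfl hs
  have hm : s ∈ Finset.Icc 1 τ := Finset.mem_Icc.2 ⟨h1, by omega⟩
  exact ⟨hm, h.cut_subset s hm ⟨interior_subset (h.x_mem s hm), by simp⟩ _ h3⟩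

theorem IsRun.initial_le (h : T.IsRun P δ τ) {y : Euc n} (hy : y ∈ T.Q 1) (i : Fin T.m) :
    inner ℝ (T.initNormal i) y ≤ T.initOffset i :=
  hy (Sum.inl i) (by simp [h.active_one])

theorem mem_prodCuts {i : Fin T.m ⊕ ℕ} : i ∈ T.prodCuts P τ ↔
    i ∈ T.active (τ + 1) ∧ ∃ t, i = Sum.inr t ∧ T.x t ∈ interior P.X := by
  simp [prodCuts]

theorem mem_prodSteps {t : ℕ} : t ∈ T.prodSteps P τ ↔
    t ∈ Finset.Icc 1 τ ∧ T.x t ∈ interior P.X := by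
  simp [prodSteps]

theorem prodCuts_subset : T.prodCuts P τ ⊆ T.active (τ + 1) :=
  fun _ hi => (mem_prodCuts.1 hi).1

/-- The constraints that were not added at productive steps are valid on the feasible set. -/
theorem IsRun.le_of_notMem_prodCuts (h : T.IsRun P δ τ) {i : Fin T.m ⊕ ℕ}
    (hi : i ∈ T.active (τ + 1)) (hi' : i ∉ T.prodCuts P τ) {y : Euc n} (hy : y ∈ P.X) :
    inner ℝ (T.a i) y ≤ T.b i := by
  rcases i with i | t
  · exact h.initial_le (h.X_subset hy) i
  · obtain ⟨h1, h2⟩ := h.inner_le_cutOffset hi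
    have h3 := h.nonproductive t h1 (fun hx => hi' (mem_prodCuts.2 ⟨hi, t, rfl, hx⟩)) y hy
    rw [inner_sub_right] at h3
    change inner ℝ (T.e t) y ≤ T.cutOffset t
    linarith

theorem inner_le_W {t : ℕ} (ht : t ∈ T.prodSteps P τ)
    {y : Euc n} (hy : y ∈ P.X) : inner ℝ (T.e t) (y - T.x t) ≤ T.W P τ := by
  refine le_csSup ?_ ⟨t, ht, y, hy, rfl⟩
  refine ⟨∑ t ∈ T.prodSteps P τ, ‖T.e t‖ * Metric.diam P.X, ?_⟩
  rintro w ⟨t, ht, y, hy, rfl⟩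
  have hx := interior_subset (mem_prodSteps.1 ht).2
  calc inner ℝ (T.e t) (y - T.x t) ≤ ‖T.e t‖ * ‖y - T.x t‖ := real_inner_le_norm _ _
    _ ≤ ‖T.e t‖ * Metric.diam P.X := by
      gcongr
      rw [← dist_eq_norm]
      exact Metric.dist_le_diam_of_mem P.compact_X.isBounded hy hx
    _ ≤ _ := Finset.single_le_sum (f := fun t => ‖T.e t‖ * Metric.diam P.X)
      (fun _ _ => mul_nonneg (norm_nonneg _) Metric.diam_nonneg) ht

/-! ### Estimates for the linear program -/

/-- The total weighted slack at `c` is at most `2`. A productive cut has slack at least `r ‖e_t‖ -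
W`, seen by evaluating `⟨e_t, · - x_t⟩ ≤ W` at the extreme point of the ball in direction `e_t`; the
other slacks are nonnegative. -/
theorem IsRun.lpObj_mul_le (h : T.IsRun P δ τ) {lam : Fin T.m ⊕ ℕ → ℝ}
    (hl : T.LPFeasible τ lam) {c : Euc n} {r : ℝ} (hr : 0 < r)
    (hc : Metric.closedBall c r ⊆ P.X) :
    r * T.lpObj P τ lam - 2 ≤ T.W P τ * T.dSum P τ lam := by
  obtain ⟨h0, h1, h2⟩ := hl
  have hsum : ∑ i ∈ T.active (τ + 1), lam i * (T.b i - inner ℝ (T.a i) c) ≤ 2 := by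
    have : ∑ i ∈ T.active (τ + 1), lam i * inner ℝ (T.a i) c = 0 := by
      simpa [sum_inner, real_inner_smul_left] using congrArg (fun v => inner ℝ v c) h1
    simp only [mul_sub, Finset.sum_sub_distrib, this]
    linarith [h2.2]
  have hprod : ∑ i ∈ T.prodCuts P τ, lam i * (r * ‖T.a i‖ - T.W P τ)
      ≤ ∑ i ∈ T.prodCuts P τ, lam i * (T.b i - inner ℝ (T.a i) c) := by
    refine Finset.sum_le_sum fun i hi => ?_
    obtain ⟨hia, t, rfl, hx⟩ := mem_prodCuts.1 hi
    obtain ⟨h3, h4⟩ := h.inner_le_cutOffset hia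
    have h5 := inner_le_W (mem_prodSteps.2 ⟨h3, hx⟩)
      (hc (add_smul_div_norm_mem_closedBall (T.e t) c hr.le))
    rw [inner_sub_right, inner_add_smul_div_norm] at h5
    refine mul_le_mul_of_nonneg_left ?_ (h0 _ hia)
    change r * ‖T.e t‖ - T.W P τ ≤ T.cutOffset t - inner ℝ (T.e t) c
    linarith
  have hle : ∑ i ∈ T.prodCuts P τ, lam i * (T.b i - inner ℝ (T.a i) c)
      ≤ ∑ i ∈ T.active (τ + 1), lam i * (T.b i - inner ℝ (T.a i) c) := by
    refine Finset.sum_le_sum_of_subset_of_nonneg prodCuts_subset fun i hi hi' => ?_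
    exact mul_nonneg (h0 i hi) (sub_nonneg.2
      (h.le_of_notMem_prodCuts hi hi' (hc (Metric.mem_closedBall_self hr.le))))
  have e : ∑ i ∈ T.prodCuts P τ, lam i * (r * ‖T.a i‖ - T.W P τ)
      = r * T.lpObj P τ lam - T.W P τ * T.dSum P τ lam := by
    rw [lpObj, dSum, Finset.mul_sum, Finset.mul_sum, ← Finset.sum_sub_distrib]
    exact Finset.sum_congr rfl fun i _ => by ring
  linarith

/-- If `Q (τ + 1)` contains no open ball of radius `s`, the linear program has a feasible point with
a large objective. -/
theorem IsRun.exists_feasible (h : T.IsRun P δ τ) {s r : ℝ} (hs : 0 < s)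
    (hQ : ∀ z, ¬ Metric.ball z s ⊆ T.Q (τ + 1)) {c : Euc n} (hr : 0 < r)
    (hc : Metric.closedBall c r ⊆ P.X) :
    ∃ mu, T.LPFeasible τ mu ∧
      2 * (r - s) / s ≤ T.lpObj P τ mu * (r + Metric.diam (T.Q 1)) := by
  classical
  obtain ⟨q, hq⟩ := h.interior_nonempty (τ + 1) (Finset.mem_Icc.2 ⟨by omega, le_rfl⟩)
  replace hq := interior_subset hq
  let A := T.active (τ + 1)
  -- Zero normals are left out so that a nontrivial `μ` has positive weighted norm `N`.
  let I := A.filter fun i => T.a i ≠ 0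
  obtain ⟨μ, hμ0, ⟨j, hj, hμj⟩, hμa, hμc⟩ := exists_nonneg_combination_of_infeasible I T.a
    (fun i => T.b i - s * ‖T.a i‖) (by
      intro z
      by_contra! hz
      refine hQ z fun y hy i hi => ?_
      by_cases ha : T.a i = 0
      · simpa [ha] using hq i hi
      · have h1 := hz i (Finset.mem_filter.2 ⟨hi, ha⟩)
        have h2 : inner ℝ (T.a i) (y - z) ≤ ‖T.a i‖ * s :=
          (real_inner_le_norm _ _).trans (mul_le_mul_of_nonneg_left
            (by rw [← dist_eq_norm]; exact (Metric.mem_ball.1 hy).le) (norm_nonneg _))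
        rw [inner_sub_right] at h2
        linarith)
  let N := ∑ i ∈ I, μ i * ‖T.a i‖
  have hN : 0 < N := Finset.sum_pos' (fun i _ => mul_nonneg (hμ0 i) (norm_nonneg _))
    ⟨j, hj, mul_pos hμj (norm_pos_iff.2 (Finset.mem_filter.1 hj).2)⟩
  -- This scaling gives `∑ mu_i ‖a_i‖ = 2 / s`, for which Gordan's inequality reads `∑ mu_i b_i ≤
  -- 2`.
  let k := 2 / (s * N)
  have hk : 0 < k := by positivity
  let mu : Fin T.m ⊕ ℕ → ℝ := fun i => if T.a i ≠ 0 then k * μ i else 0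
  have hmu0 : ∀ i, 0 ≤ mu i := by
    intro i
    simp only [mu]
    split_ifs
    · exact mul_nonneg hk.le (hμ0 i)
    · exact le_rfl
  have hsumI : ∀ f : Fin T.m ⊕ ℕ → ℝ, ∑ i ∈ A, mu i * f i = k * ∑ i ∈ I, μ i * f i := by
    intro f
    simp only [I, mu, Finset.sum_filter, Finset.mul_sum]
    exact Finset.sum_congr rfl fun i _ => by split_ifs <;> ring
  have hmua : ∑ i ∈ A, mu i • T.a i = 0 := by
    have : ∑ i ∈ A, mu i • T.a i = k • ∑ i ∈ I, μ i • T.a i := by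
      simp only [I, mu, Finset.sum_filter, Finset.smul_sum]
      exact Finset.sum_congr rfl fun i _ => by split_ifs <;> simp [mul_smul]
    rw [this, hμa, smul_zero]
  have hinner : ∀ y, ∑ i ∈ A, mu i * inner ℝ (T.a i) y = 0 := by
    intro y
    simpa [sum_inner, real_inner_smul_left] using congrArg (fun v => inner ℝ v y) hmua
  have hnorm : ∑ i ∈ A, mu i * ‖T.a i‖ = 2 / s := by
    rw [hsumI fun i => ‖T.a i‖]
    change 2 / (s * N) * N = _
    field_simp
  -- Nonemptiness of the localizer is what makes the lower constraint hold.
  have hb0 : 0 ≤ ∑ i ∈ A, mu i * T.b i := by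
    rw [← hinner q]
    exact Finset.sum_le_sum fun i hi => mul_le_mul_of_nonneg_left (hq i hi) (hmu0 i)
  have hb2 : ∑ i ∈ A, mu i * T.b i ≤ 2 := by
    have e : ∑ i ∈ A, mu i * (T.b i - s * ‖T.a i‖)
        = ∑ i ∈ A, mu i * T.b i - s * ∑ i ∈ A, mu i * ‖T.a i‖ := by
      rw [Finset.mul_sum, ← Finset.sum_sub_distrib]
      exact Finset.sum_congr rfl fun i _ => by ring
    have e2 : s * (2 / s) = 2 := by field_simp
    rw [hnorm, e2, hsumI fun i => T.b i - s * ‖T.a i‖] at e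
    have := mul_nonpos_of_nonneg_of_nonpos hk.le hμc
    linarith
  refine ⟨mu, ⟨fun i _ => hmu0 i, hmua, hb0, hb2⟩, ?_⟩
  -- A constraint valid on `X` has slack at least `r ‖a_i‖` at `c`, while a productive cut has slack
  -- at least `-D ‖a_i‖`. The correction `(r + D) ‖a_i‖` covers the difference.
  have hterm : ∀ i ∈ A, mu i * (r * ‖T.a i‖) - (if i ∈ T.prodCuts P τ then
      mu i * ‖T.a i‖ * (r + Metric.diam (T.Q 1)) else 0) ≤ mu i * (T.b i - inner ℝ (T.a i) c) := by
    intro i hi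
    split_ifs with hp
    · obtain ⟨hia, t, rfl, hx⟩ := mem_prodCuts.1 hp
      obtain ⟨h3, h4⟩ := h.inner_le_cutOffset hia
      have h5 : inner ℝ (T.e t) (c - T.x t) ≤ ‖T.e t‖ * Metric.diam (T.Q 1) :=
        (real_inner_le_norm _ _).trans (mul_le_mul_of_nonneg_left (by
          rw [← dist_eq_norm]
          exact Metric.dist_le_diam_of_mem (h.bounded 1 (Finset.mem_Icc.2 ⟨le_rfl, by omega⟩))
            (h.X_subset (hc (Metric.mem_closedBall_self hr.le)))
            (h.X_subset (interior_subset hx))) (norm_nonneg _))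
      rw [inner_sub_right] at h5
      have h6 := mul_le_mul_of_nonneg_left (a := mu (Sum.inr t))
        (b := -(‖T.e t‖ * Metric.diam (T.Q 1))) (c := T.cutOffset t - inner ℝ (T.e t) c)
        (by linarith) (hmu0 _)
      change _ ≤ mu (Sum.inr t) * (T.cutOffset t - inner ℝ (T.e t) c)
      change mu (Sum.inr t) * (r * ‖T.e t‖) - mu (Sum.inr t) * ‖T.e t‖ * _ ≤ _
      linarith
    · have h5 := h.le_of_notMem_prodCuts hi hp
        (hc (add_smul_div_norm_mem_closedBall (T.a i) c hr.le))
      rw [inner_add_smul_div_norm] at h5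
      rw [sub_zero]
      exact mul_le_mul_of_nonneg_left (by linarith) (hmu0 i)
  have hsum := Finset.sum_le_sum hterm
  have e1 : ∑ i ∈ A, mu i * (r * ‖T.a i‖) = r * (2 / s) := by
    rw [← hnorm, Finset.mul_sum]
    exact Finset.sum_congr rfl fun i _ => by ring
  have e2 : (∑ i ∈ A, if i ∈ T.prodCuts P τ then
      mu i * ‖T.a i‖ * (r + Metric.diam (T.Q 1)) else 0)
      = T.lpObj P τ mu * (r + Metric.diam (T.Q 1)) := by
    rw [← Finset.sum_filter, Finset.filter_mem_eq_inter,
      Finset.inter_eq_right.2 prodCuts_subset, lpObj, Finset.sum_mul]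
  have e3 : 2 * (r - s) / s = r * (2 / s) - 2 := by field_simp
  simp only [mul_sub (mu _) (T.b _), Finset.sum_sub_distrib, hinner, e1, e2] at hsum
  linarith

/-! ### The induced certificate and its residual -/

theorem IsRun.isCertificate (h : T.IsRun P δ τ) {lam : Fin T.m ⊕ ℕ → ℝ}
    (hl : T.LPFeasible τ lam) (hd : 0 < T.dSum P τ lam) :
    T.IsCertificate P τ (T.certOf P τ lam) := by
  classical
  refine ⟨fun t _ => ?_, ?_⟩
  · rw [certOf]
    split_ifs with ht
    · exact div_nonneg (hl.1 _ ht) hd.le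
    · exact le_rfl
  · have : ∑ t ∈ T.prodSteps P τ, T.certOf P τ lam t = T.dSum P τ lam / T.dSum P τ lam := by
      simp only [certOf]
      rw [← Finset.sum_filter, ← Finset.sum_div]
      congr 1
      refine Finset.sum_bij (fun t _ => Sum.inr t) ?_ ?_ ?_ ?_
      · intro t ht
        obtain ⟨h1, h2⟩ := Finset.mem_filter.1 ht
        exact mem_prodCuts.2 ⟨h2, t, rfl, (mem_prodSteps.1 h1).2⟩
      · intro t _ t' _ e
        exact Sum.inr_injective e
      · intro i hi
        obtain ⟨h1, t, rfl, h2⟩ := mem_prodCuts.1 hi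
        exact ⟨t, Finset.mem_filter.2
          ⟨mem_prodSteps.2 ⟨(h.inner_le_cutOffset h1).1, h2⟩, h1⟩, rfl⟩
      · intro t _
        rfl
    rw [this, div_self hd.ne']

/-- The total weighted slack at `y` is at most `2`. Initial constraints may be dropped, being valid
on `Q_1`, and each cut has slack at least `⟨e_t, x_t - y⟩`. -/
theorem IsRun.residual_le (h : T.IsRun P δ τ) {lam : Fin T.m ⊕ ℕ → ℝ}
    (hl : T.LPFeasible τ lam) (hd : 0 < T.dSum P τ lam) {y : Euc n} (hy : y ∈ T.Q 1) :
    ∑ t ∈ Finset.Icc 1 τ, T.certOf P τ lam t * inner ℝ (T.e t) (T.x t - y)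
      ≤ 2 / T.dSum P τ lam := by
  classical
  obtain ⟨h0, h1, h2⟩ := hl
  have hsum : ∑ i ∈ T.active (τ + 1), lam i * (T.b i - inner ℝ (T.a i) y) ≤ 2 := by
    have : ∑ i ∈ T.active (τ + 1), lam i * inner ℝ (T.a i) y = 0 := by
      simpa [sum_inner, real_inner_smul_left] using congrArg (fun v => inner ℝ v y) h1
    simp only [mul_sub, Finset.sum_sub_distrib, this]
    linarith [h2.2]
  let B := (Finset.Icc 1 τ).filter fun t => Sum.inr t ∈ T.active (τ + 1)
  have hle : ∑ t ∈ B, lam (Sum.inr t) * (T.cutOffset t - inner ℝ (T.e t) y)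
      ≤ ∑ i ∈ T.active (τ + 1), lam i * (T.b i - inner ℝ (T.a i) y) := by
    have e : ∑ t ∈ B, lam (Sum.inr t) * (T.cutOffset t - inner ℝ (T.e t) y)
        = ∑ i ∈ B.map ⟨Sum.inr, Sum.inr_injective⟩, lam i * (T.b i - inner ℝ (T.a i) y) := by
      rw [Finset.sum_map]; rfl
    rw [e]
    refine Finset.sum_le_sum_of_subset_of_nonneg ?_ ?_
    · intro i hi
      obtain ⟨t, ht, rfl⟩ := Finset.mem_map.1 hi
      exact (Finset.mem_filter.1 ht).2
    · rintro (i | t) hi hi'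
      · exact mul_nonneg (h0 _ hi) (sub_nonneg.2 (h.initial_le hy i))
      · exact absurd (Finset.mem_map.2 ⟨t, Finset.mem_filter.2
          ⟨(h.inner_le_cutOffset hi).1, hi⟩, rfl⟩) hi'
  have e : ∑ t ∈ Finset.Icc 1 τ, T.certOf P τ lam t * inner ℝ (T.e t) (T.x t - y)
      = (∑ t ∈ B, lam (Sum.inr t) * inner ℝ (T.e t) (T.x t - y)) / T.dSum P τ lam := by
    rw [Finset.sum_filter, Finset.sum_div]
    refine Finset.sum_congr rfl fun t _ => ?_
    rw [certOf]
    split_ifs <;> ring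
  rw [e]
  refine div_le_div_of_nonneg_right ((Finset.sum_le_sum fun t ht => ?_).trans (hle.trans hsum)) hd.le
  have ht' := (Finset.mem_filter.1 ht).2
  refine mul_le_mul_of_nonneg_left ?_ (h0 _ ht')
  rw [inner_sub_right]
  linarith [(h.inner_le_cutOffset ht').2]

/-! ### Lower bound for the productive weight -/

theorem lpObj_nonneg {mu : Fin T.m ⊕ ℕ → ℝ} (hl : T.LPFeasible τ mu) : 0 ≤ T.lpObj P τ mu :=
  Finset.sum_nonneg fun i hi => mul_nonneg (hl.1 i (prodCuts_subset hi)) (norm_nonneg _)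

theorem dSum_nonneg {mu : Fin T.m ⊕ ℕ → ℝ} (hl : T.LPFeasible τ mu) : 0 ≤ T.dSum P τ mu :=
  Finset.sum_nonneg fun i hi => hl.1 i (prodCuts_subset hi)

theorem IsRun.inradius_pos (h : T.IsRun P δ τ) (hn : 0 < n) :
    0 < inradius P.X ∧ inradius P.X ≤ Metric.diam (T.Q 1) :=
  ⟨_root_.inradius_pos hn P.compact_X.isBounded P.interior_nonempty,
    inradius_le_diam hn (h.bounded 1 (Finset.mem_Icc.2 ⟨le_rfl, by omega⟩)) h.X_subset⟩

/-- A nearly optimal solution of the linear program has `d_τ` bounded away from zero. -/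
theorem IsRun.le_W_mul_dSum (h : T.IsRun P δ τ) (hn : 0 < n) {α : ℝ} (hα0 : 0 ≤ α) (hα1 : α < 1)
    (hρ : rho (T.Q (τ + 1)) ≤ (1 - α) * inradius P.X ^ 2 / (16 * n * Metric.diam (T.Q 1)))
    {lamStar lam : Fin T.m ⊕ ℕ → ℝ} (hs : T.LPOptimal P τ lamStar)
    (hl : T.LPFeasible τ lam) (hle : (1 - α) * T.lpObj P τ lamStar ≤ T.lpObj P τ lam) :
    0 < rho (T.Q (τ + 1)) ∧
    (1 - α) * inradius P.X ^ 2 ≤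
      8 * n * (rho (T.Q (τ + 1)) * Metric.diam (T.Q 1)) * (T.W P τ * T.dSum P τ lam) := by
  obtain ⟨hR, hRD⟩ := h.inradius_pos hn
  have hmem : τ + 1 ∈ Finset.Icc 1 (τ + 1) := Finset.mem_Icc.2 ⟨by omega, le_rfl⟩
  have hbd := h.bounded _ hmem
  have hρ0 : 0 < rho (T.Q (τ + 1)) := rho_pos hn hbd (h.interior_nonempty _ hmem)
  -- Any radius above `ρ` is excluded by volume; the factor `2` gives a strict margin.
  have hball : ∀ z, ¬ Metric.ball z (2 * rho (T.Q (τ + 1))) ⊆ T.Q (τ + 1) := fun z hz => by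
    have := le_rho_of_ball_subset hn hbd hz
    linarith
  -- Attainment of the inradius `R` is not needed: the constants leave room for a ball of radius
  -- above `9/10 R`.
  obtain ⟨r, c, hrR, hc⟩ := exists_closedBall_subset_of_lt_inradius
    (X := P.X) (s := 9 / 10 * inradius P.X) (by positivity) (by linarith)
  have hr : 0 < r := lt_trans (by positivity) hrR
  have hrD : r ≤ Metric.diam (T.Q 1) := le_diam_of_closedBall_subset hn
    (h.bounded 1 (Finset.mem_Icc.2 ⟨le_rfl, by omega⟩)) hr.le (hc.trans h.X_subset)
  obtain ⟨mu, hmu, hobj⟩ := h.exists_feasible (by positivity) hball hr hc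
  have hobj0 := lpObj_nonneg (P := P) hmu
  have hd := h.lpObj_mul_le hl hr hc
  have hopt := hs.2 mu hmu
  generalize T.lpObj P τ mu = M at *
  generalize T.lpObj P τ lamStar = Ls at *
  generalize T.lpObj P τ lam = L at *
  generalize T.W P τ * T.dSum P τ lam = V at *
  generalize rho (T.Q (τ + 1)) = ρ at *
  generalize Metric.diam (T.Q 1) = D at *
  generalize inradius P.X = R at *
  obtain ⟨β, rfl⟩ : ∃ β, α = 1 - β := ⟨1 - α, by ring⟩
  simp only [sub_sub_cancel] at *
  have hβ0 : 0 < β := by linarith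
  have hβ1 : β ≤ 1 := by linarith
  have hn1 : (1 : ℝ) ≤ n := by exact_mod_cast hn
  have hD : 0 < D := by linarith
  refine ⟨hρ0, ?_⟩
  rw [le_div_iff₀ (by positivity)] at hρ
  have hρD : 0 < ρ * D := by positivity
  have h16 : 16 * (ρ * D) ≤ β * R ^ 2 := by
    nlinarith [mul_le_mul_of_nonneg_left hn1 hρD.le]
  have hρR : 16 * ρ ≤ R := by
    have h1 : β * R ^ 2 ≤ D * R := by
      calc β * R ^ 2 ≤ 1 * R ^ 2 := by gcongr
        _ = R * R := by ring
        _ ≤ D * R := by gcongr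
    refine le_of_mul_le_mul_right ?_ hD
    linarith
  have hM : r - 2 * ρ ≤ 2 * (ρ * D) * M := by
    rw [div_le_iff₀ (by positivity)] at hobj
    have h1 : M * (r + D) ≤ M * (2 * D) := by gcongr; linarith
    have h2 := mul_le_mul_of_nonneg_right h1 hρ0.le
    linarith
  have hL : β * M ≤ L := (mul_le_mul_of_nonneg_left hopt hβ0.le).trans hle
  -- Here `31/40 = 9/10 - 1/8`, since `16 ρ ≤ R`.
  have h3 : 31 / 40 * R ≤ r - 2 * ρ := by linarith
  have h4 : β * (9 / 10 * R * (31 / 40 * R)) ≤ 2 * (ρ * D) * (r * L) := by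
    calc β * (9 / 10 * R * (31 / 40 * R)) ≤ β * (r * (r - 2 * ρ)) := by
          gcongr
      _ ≤ β * (r * (2 * (ρ * D) * M)) := by gcongr
      _ = 2 * (ρ * D) * (r * (β * M)) := by ring
      _ ≤ _ := by gcongr
  have h5 : 2 * (ρ * D) * (r * L) ≤ 2 * (ρ * D) * (V + 2) := by gcongr; linarith
  -- The left side of `h4` exceeds `β R² / 2`, and `4 ρ D ≤ β R² / 4` by `h16`, so `2 ρ D V ≥ β R² /
  -- 4`.
  have h6 : β * R ^ 2 ≤ 8 * (ρ * D) * V := by linarith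
  have h7 : 8 * (ρ * D) * V ≤ n * (8 * (ρ * D) * V) :=
    le_mul_of_one_le_left (le_trans (by positivity) h6) hn1
  linarith

/-! ### Bounded variation, final bounds and near-optimality -/

theorem inner_le_of_variationLE {x y e : Euc n} {C : ℝ} (hC : P.VariationLE C)
    (hx : x ∈ interior P.X) (hy : y ∈ P.X) (he : P.IsDeltaSubgradient δ x e) :
    inner ℝ e (y - x) ≤ C + δ := by
  have h1 := he y hy
  have h2 := hC y hy x (interior_subset hx)
  generalize hw : (inner ℝ e (y - x) : ℝ) = w at *
  lift P.F x to ℝ using ⟨P.F_ne_top x hx, P.F_ne_bot x (interior_subset hx)⟩ with fx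
  -- As `F x` is finite, an infinite value at `y` would violate the variation bound.
  have h3 : P.F y ≠ ⊤ := by
    intro ht
    rw [ht, EReal.top_sub_coe] at h2
    exact absurd h2 (not_le.2 (EReal.coe_lt_top _))
  lift P.F y to ℝ using ⟨h3, P.F_ne_bot y hy⟩ with fy
  norm_cast at h1 h2
  linarith

theorem IsRun.W_le (h : T.IsRun P δ τ) {C : ℝ} (hC : P.VariationLE C) (hW : 0 < T.W P τ) :
    T.W P τ ≤ C + δ := by
  refine csSup_le ?_ ?_
  -- Without productive steps the supremum takes the default value `0`, which `hW` excludes.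
  · by_contra! he
    rw [W, he, Real.sSup_empty] at hW
    exact lt_irrefl _ hW
  · rintro w ⟨t, ht, y, hy, rfl⟩
    obtain ⟨h1, h2⟩ := mem_prodSteps.1 ht
    exact inner_le_of_variationLE hC h2 hy (h.productive t h1 h2)

theorem IsRun.certificate_bounds (h : T.IsRun P δ τ) (hn : 0 < n) {α : ℝ} (hα0 : 0 ≤ α)
    (hα1 : α < 1)
    (hρ : rho (T.Q (τ + 1)) ≤ (1 - α) * inradius P.X ^ 2 / (16 * n * Metric.diam (T.Q 1)))
    {lamStar lam : Fin T.m ⊕ ℕ → ℝ} (hs : T.LPOptimal P τ lamStar)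
    (hl : T.LPFeasible τ lam) (hle : (1 - α) * T.lpObj P τ lamStar ≤ T.lpObj P τ lam) :
    0 < T.W P τ ∧ 0 < T.dSum P τ lam ∧ T.epsCert τ (T.certOf P τ lam) (T.Q 1) ≤
      16 * n * Metric.diam (T.Q 1) * T.W P τ / ((1 - α) * inradius P.X ^ 2)
        * rho (T.Q (τ + 1)) := by
  obtain ⟨hR, hRD⟩ := h.inradius_pos hn
  obtain ⟨hρ0, hmain⟩ := h.le_W_mul_dSum hn hα0 hα1 hρ hs hl hle
  have hn0 : (0 : ℝ) < n := by exact_mod_cast hn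
  have hD : 0 < Metric.diam (T.Q 1) := hR.trans_le hRD
  have hβ : 0 < (1 - α) * inradius P.X ^ 2 := mul_pos (by linarith) (by positivity)
  -- Only the product is bounded below; `d ≥ 0` then makes both factors positive.
  have hWd : 0 < T.W P τ * T.dSum P τ lam := pos_of_mul_pos_right (hβ.trans_le hmain) (by positivity)
  have hd : 0 < T.dSum P τ lam := (dSum_nonneg hl).lt_of_ne fun e => by simp [← e] at hWd
  have hW : 0 < T.W P τ := pos_of_mul_pos_left hWd hd.le
  refine ⟨hW, hd, ?_⟩
  have h2 : 2 / T.dSum P τ lam ≤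
      16 * n * Metric.diam (T.Q 1) * T.W P τ / ((1 - α) * inradius P.X ^ 2)
        * rho (T.Q (τ + 1)) := by
    rw [div_mul_eq_mul_div, div_le_div_iff₀ hd hβ]
    linarith
  refine Real.sSup_le ?_ (le_trans (by positivity) h2)
  rintro _ ⟨y, hy, rfl⟩
  exact (h.residual_le hl hd hy).trans h2

theorem IsRun.le_epsCert (h : T.IsRun P δ τ) {lam : Fin T.m ⊕ ℕ → ℝ}
    (hl : T.LPFeasible τ lam) (hd : 0 < T.dSum P τ lam) {y : Euc n} (hy : y ∈ T.Q 1) :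
    ∑ t ∈ Finset.Icc 1 τ, T.certOf P τ lam t * inner ℝ (T.e t) (T.x t - y)
      ≤ T.epsCert τ (T.certOf P τ lam) (T.Q 1) :=
  le_csSup ⟨2 / T.dSum P τ lam, by rintro _ ⟨y, hy, rfl⟩; exact h.residual_le hl hd hy⟩
    ⟨y, hy, rfl⟩

/-- A certificate whose residual on the feasible set is at most `ε - δ` induces a strictly feasible
`ε`-optimal solution. -/
theorem IsRun.isEpsOptimal (h : T.IsRun P δ τ) {ξ : ℕ → ℝ} (hξ : T.IsCertificate P τ ξ) {ε : ℝ}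
    (hres : ∀ y ∈ P.X, ∑ t ∈ Finset.Icc 1 τ, ξ t * inner ℝ (T.e t) (T.x t - y) ≤ ε - δ) :
    P.IsEpsOptimal ε (T.approxSol P τ ξ) := by
  classical
  obtain ⟨hξ0, h1⟩ := hξ
  have h0 : ∀ t ∈ T.prodSteps P τ, 0 ≤ ξ t := fun t ht => hξ0 t (mem_prodSteps.1 ht).1
  have hint : T.approxSol P τ ξ ∈ interior P.X :=
    P.convex_X.interior.sum_mem h0 h1 fun t ht => (mem_prodSteps.1 ht).2
  refine ⟨hint, ?_⟩
  have hval : ∀ t ∈ T.prodSteps P τ, P.F (T.x t) = ((P.F (T.x t)).toReal : EReal) := fun t ht =>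
    (EReal.coe_toReal (P.F_ne_top _ (mem_prodSteps.1 ht).2)
      (P.F_ne_bot _ (interior_subset (mem_prodSteps.1 ht).2))).symm
  have hjensen : P.F (T.approxSol P τ ξ) ≤
      ((∑ t ∈ T.prodSteps P τ, ξ t * (P.F (T.x t)).toReal : ℝ) : EReal) := by
    -- Jensen's inequality, as a convex combination of points of the epigraph.
    have := P.convex_F.sum_mem h0 h1 (z := fun t => (T.x t, (P.F (T.x t)).toReal)) fun t ht =>
      ⟨interior_subset (mem_prodSteps.1 ht).2, (hval t ht).le⟩
    have h2 := this.2
    simpa [Prod.fst_sum, Prod.snd_sum, approxSol] using h2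
  rw [← EReal.sub_le_iff_le_add (by simp) (by simp), ConvexProblem.opt]
  refine le_iInf₂ fun y hy => ?_
  rw [EReal.sub_le_iff_le_add (by simp) (by simp)]
  refine hjensen.trans ?_
  rcases eq_or_ne (P.F y) ⊤ with hy' | hy'
  · simp [hy']
  have hsub : ∀ t ∈ T.prodSteps P τ,
      (P.F (T.x t)).toReal + (inner ℝ (T.e t) (y - T.x t) - δ) ≤ (P.F y).toReal := by
    intro t ht
    obtain ⟨h2, h3⟩ := mem_prodSteps.1 ht
    have h4 := h.productive t h2 h3 y hy
    rw [hval t ht, ← EReal.coe_toReal hy' (P.F_ne_bot y hy)] at h4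
    exact_mod_cast h4
  rw [← EReal.coe_toReal hy' (P.F_ne_bot y hy)]
  norm_cast
  -- For `y ∈ X` the nonproductive terms are nonnegative, so discarding them only lowers the sum.
  have hprod : ∑ t ∈ T.prodSteps P τ, ξ t * inner ℝ (T.e t) (T.x t - y) ≤ ε - δ := by
    refine (Finset.sum_le_sum_of_subset_of_nonneg
      (fun t ht => (mem_prodSteps.1 ht).1) fun t ht ht' => ?_).trans (hres y hy)
    have h5 := h.nonproductive t ht (fun hx => ht' (mem_prodSteps.2 ⟨ht, hx⟩)) y hy
    rw [← neg_sub, inner_neg_right] at h5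
    exact mul_nonneg (hξ0 t ht) (by linarith)
  have hsum : ∑ t ∈ T.prodSteps P τ, ξ t * (P.F (T.x t)).toReal ≤
      ∑ t ∈ T.prodSteps P τ,
        (ξ t * ((P.F y).toReal + δ) + ξ t * inner ℝ (T.e t) (T.x t - y)) := by
    refine Finset.sum_le_sum fun t ht => ?_
    rw [← mul_add]
    refine mul_le_mul_of_nonneg_left ?_ (h0 t ht)
    have h6 := hsub t ht
    rw [← neg_sub (T.x t) y, inner_neg_right] at h6
    linarith
  rw [Finset.sum_add_distrib, ← Finset.sum_mul, h1] at hsum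
  linarith

end CuttingPlaneTrace

/-! ### The two claims -/

theorem corollary1 {n : ℕ} (hn : 0 < n) (P : ConvexProblem n) (δ : ℝ)
    (T : CuttingPlaneTrace n) (α : ℝ) (hα0 : 0 ≤ α) (hα1 : α < 1) :
    (∀ τ : ℕ, 1 ≤ τ → T.IsRun P δ τ →
      rho (T.Q (τ + 1)) ≤ (1 - α) * inradius P.X ^ 2 / (16 * n * Metric.diam (T.Q 1)) →
      ∀ lamStar lam : Fin T.m ⊕ ℕ → ℝ,
        T.LPOptimal P τ lamStar → T.LPFeasible τ lam →
        (1 - α) * T.lpObj P τ lamStar ≤ T.lpObj P τ lam →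
        0 < T.dSum P τ lam ∧
        T.IsCertificate P τ (T.certOf P τ lam) ∧
        T.epsCert τ (T.certOf P τ lam) (T.Q 1) ≤
          16 * n * Metric.diam (T.Q 1) * T.W P τ / ((1 - α) * inradius P.X ^ 2)
            * rho (T.Q (τ + 1)) ∧
        ∀ C : ℝ, P.VariationLE C →
          T.W P τ ≤ C + δ ∧
          T.epsCert τ (T.certOf P τ lam) (T.Q 1) ≤
            16 * n * Metric.diam (T.Q 1) * (C + δ) / ((1 - α) * inradius P.X ^ 2)
              * rho (T.Q (τ + 1))) ∧
    (∀ C : ℝ, P.VariationLE C →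
      (∀ τ : ℕ, 1 ≤ τ → T.IsRun P δ τ) →
      Tendsto (fun t => rho (T.Q t)) atTop (𝓝 0) →
      ∀ lamStar lam : ℕ → Fin T.m ⊕ ℕ → ℝ,
        (∀ τ : ℕ, 1 ≤ τ → T.LPOptimal P τ (lamStar τ) ∧ T.LPFeasible τ (lam τ) ∧
          (1 - α) * T.lpObj P τ (lamStar τ) ≤ T.lpObj P τ (lam τ)) →
        (∀ η : ℝ, 0 < η →
          ∀ᶠ τ in atTop, T.epsCert τ (T.certOf P τ (lam τ)) (T.Q 1) ≤ η) ∧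
        ∀ ε : ℝ, δ < ε →
          ∀ᶠ τ in atTop, P.IsEpsOptimal ε (T.approxSol P τ (T.certOf P τ (lam τ)))) := by
  have hn0 : (0 : ℝ) < n := by exact_mod_cast hn
  refine ⟨fun τ _ h hρ lamStar lam hs hl hle => ?_, fun C hC hrun hlim lamStar lam hlam => ?_⟩
  · obtain ⟨hW, hd, heps⟩ := h.certificate_bounds hn hα0 hα1 hρ hs hl hle
    refine ⟨hd, h.isCertificate hl hd, heps, fun C hC => ?_⟩
    have hWC := h.W_le hC hW
    obtain ⟨hR, hRD⟩ := h.inradius_pos hn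
    have hD := hR.trans_le hRD
    have hβ : 0 < 1 - α := by linarith
    refine ⟨hWC, heps.trans ?_⟩
    have : 0 ≤ rho (T.Q (τ + 1)) := Real.rpow_nonneg ENNReal.toReal_nonneg _
    gcongr
  · obtain ⟨hR, hRD⟩ := (hrun 1 le_rfl).inradius_pos hn
    have hD := hR.trans_le hRD
    have hβ : 0 < 1 - α := by linarith
    have hlim' : Tendsto (fun τ => rho (T.Q (τ + 1))) atTop (𝓝 0) :=
      hlim.comp (tendsto_add_atTop_nat 1)
    have hsmall : ∀ᶠ τ in atTop, rho (T.Q (τ + 1)) ≤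
        (1 - α) * inradius P.X ^ 2 / (16 * n * Metric.diam (T.Q 1)) :=
      hlim'.eventually_le_const (by positivity)
    have hη : ∀ η : ℝ, 0 < η →
        ∀ᶠ τ in atTop, T.epsCert τ (T.certOf P τ (lam τ)) (T.Q 1) ≤ η := by
      intro η hη
      -- `C + δ` in place of `W` makes the coefficient independent of `τ`.
      have hbound := hlim'.const_mul
        (16 * n * Metric.diam (T.Q 1) * (C + δ) / ((1 - α) * inradius P.X ^ 2))
      rw [mul_zero] at hbound
      filter_upwards [hsmall, hbound.eventually_le_const hη, eventually_ge_atTop 1]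
        with τ hρ hb hτ
      obtain ⟨hs, hl, hle⟩ := hlam τ hτ
      obtain ⟨hW, -, heps⟩ := (hrun τ hτ).certificate_bounds hn hα0 hα1 hρ hs hl hle
      refine heps.trans (le_trans ?_ hb)
      have hWC := (hrun τ hτ).W_le hC hW
      have : 0 ≤ rho (T.Q (τ + 1)) := Real.rpow_nonneg ENNReal.toReal_nonneg _
      gcongr
    refine ⟨hη, fun ε hε => ?_⟩
    filter_upwards [hsmall, hη (ε - δ) (by linarith), eventually_ge_atTop 1] with τ hρ he hτ
    obtain ⟨hs, hl, hle⟩ := hlam τ hτ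
    obtain ⟨-, hd, -⟩ := (hrun τ hτ).certificate_bounds hn hα0 hα1 hρ hs hl hle
    exact (hrun τ hτ).isEpsOptimal ((hrun τ hτ).isCertificate hl hd) fun y hy =>
      ((hrun τ hτ).le_epsCert hl hd ((hrun τ hτ).X_subset hy)).trans he
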